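/- Let $V$ be a finite set, let $M$ be a metric space with its Borel $\sigma$-algebra, let $\mathcal P(M)$ be the set of Borel probability measures on $M$, and let $D:\mathcal P(M)\times\mathcal P(M)\to[0,\infty)$ be a statistical distance (an arbitrary function suffices) and $\epsilon\in\mathbb R$. **Setting.** An acyclic structural causal model (SCM) $\mathcal C$ over $V$ consists of finitely many jointly independent noise variables $(N_w)_{w\in W}$ with values in measurable spaces, a directed acyclic graph $\mathcal G=(V,E)$ with parent sets $\mathrm{Pa}_j$, and for each $j\in V$ a measurable assignment $X_j:=f_j\big((X_i)_{i\in \mathrm{Pa}_j},(N_w)_{w\in K_j}\big)$ with values in $M$, where $K_j\subseteq W$. (The model without confounding is the case $W=V$, $K_j=\{j\}$; in general $j\ne k$ with $K_j\cap K_k\neq\emptyset$ are joined by a bidirected edge, so that $\mathcal C$ has an associated acyclic directed mixed graph, ADMG, with directed part $\mathcal G$.) It entails a law $P_X^{\mathcal C,(\emptyset)}$ of $X=(X_j)_{j\in V}$, with marginals $P_{X_j}^{\mathcal C,(\emptyset)}$. For $k\in V$ and $\tilde N_k$ an $M$-valued random variable independent of all noise variables, $P_X^{\mathcal C,do(X_k:=\tilde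 N_k)}$ is the law entailed by the SCM in which the assignment of $k$ is replaced by $X_k:=\tilde N_k$. Let $\mathcal I\subseteq V$ and $\tilde N=(\tilde N_k)_{k\in\mathcal I}$. For a directed graph $\mathcal H$ on $V$, $(\tilde N,\mathcal C)$ is *$\epsilon$-interventionally faithful* to $\mathcal H$ if for all $i\in\mathcal I$, $j\in V$ with $i\ne j$, $$D\big(P_{X_j}^{\mathcal C,(\emptyset)},P_{X_j}^{\mathcal C,do(X_i:=\tilde N_i)}\big)>\epsilon\iff\text{there is a directed path from } i \text{ to } j \text{ in }\mathcal H .$$ For $V'\subseteq V$, the *latent projection* of an ADMG onto $V'$ is the ADMG $\mathcal G'=(V',E',B)$ in which $(i,j)\in E'$ iff there is a directed path from $i$ to $j$ with all intermediate nodes in $V\setminus V'$, and $B$ contains $\{j,k\}$, $j\neq k$, iff $j$ and $k$ are joined by a path with arrowheads at both ends whose intermediate nodes are all non-colliders in $V\setminus V'$. The *marginalized SCM* $\mathcal C'$ over $V'$ is obtained from $\mathcal C$ by recursively substituting, in the assignments of the variables in $V'$, every variable in $V\setminus V'$ by its own assignment; the noise variables and their laws are kept. **Proposition.** If $(\tilde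 N,\mathcal C)$ is $\epsilon$-interventionally faithful to the directed graph $\mathcal G$ of $\mathcal C$, then for every $V'\subseteq V$, with $\tilde N'=(\tilde N_k)_{k\in\mathcal I\cap V'}$, the pair $(\tilde N',\mathcal C')$ is $\epsilon$-interventionally faithful to the directed part $(V',E')$ of the latent projection $\mathcal G'=(V',E',B)$. -/

import Mathlib

open MeasureTheory

universe u

/-! ## Mixed graphs and latent projection -/

/-- `G` has no directed cycle. (`Relation.TransGen G.Adj i j` says that there is a directed path
with at least one edge from `i` to `j`.) -/
def Digraph.IsAcyclic {V : Type*} (G : Digraph V) : Prop :=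
  ∀ v, ¬ Relation.TransGen G.Adj v v

/-- An acyclic directed mixed graph: directed edges without directed cycle, and bidirected edges
(a symmetric irreflexive relation). -/
structure ADMG (V : Type*) where
  directed : Digraph V
  bidirected : SimpleGraph V
  acyclic : directed.IsAcyclic

/-- `LatentPath G S i j`: there is a directed path `i → u₁ → ⋯ → uₙ → j` in `G` (`n ≥ 0`) all of
whose intermediate nodes `u₁, …, uₙ` lie outside `S`. -/
inductive LatentPath {V : Type*} (G : Digraph V) (S : Set V) : V → V → Prop
  | edge {i j : V} : G.Adj i j → LatentPath G S i j
  | snoc {i u j : V} : LatentPath G S i u → u ∉ S → G.Adj u j → LatentPath G S i j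

theorem LatentPath.transGen {V : Type*} {G : Digraph V} {S : Set V} {i j : V}
    (h : LatentPath G S i j) : Relation.TransGen G.Adj i j := by
  induction h with
  | edge h => exact .single h
  | snoc _ _ h ih => exact ih.tail h

/-- `u` reaches `j` through latent nodes only: `u = j`, or `u` is latent (outside `S`) and there is
a directed path from `u` to `j` with latent intermediate nodes. -/
def LatentSource {V : Type*} (G : Digraph V) (S : Set V) (u j : V) : Prop :=
  u = j ∨ (u ∉ S ∧ LatentPath G S u j)

/-- The directed part of the latent projection onto `S`. -/
def Digraph.latentProjection {V : Type*} (G : Digraph V) (S : Set V) : Digraph S where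
  Adj i j := LatentPath G S i j

theorem Digraph.IsAcyclic.latentProjection {V : Type*} {G : Digraph V} (hG : G.IsAcyclic)
    (S : Set V) : (G.latentProjection S).IsAcyclic := by
  have key : ∀ i j : S, Relation.TransGen (G.latentProjection S).Adj i j →
      Relation.TransGen G.Adj i j := by
    intro i j h
    induction h with
    | single h => exact LatentPath.transGen h
    | tail _ h ih => exact ih.trans (LatentPath.transGen h)
  exact fun v h => hG v (key v v h)

/-- The latent projection of an ADMG onto a set `S` of observed nodes. There is an edge `i → j` if
there is a directed path from `i` to `j` with all intermediate nodes latent. There is an edge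
`j ↔ k` if `j` and `k` are joined by a path with arrowheads at both ends, whose intermediate nodes
are all latent and non-colliders: `j ← ⋯ ← u → ⋯ → k` or `j ← ⋯ ← u ↔ v → ⋯ → k`. -/
def ADMG.latentProjection {V : Type*} (G : ADMG V) (S : Set V) : ADMG S where
  directed := G.directed.latentProjection S
  bidirected :=
    { Adj := fun j k => j ≠ k ∧ ∃ u v, LatentSource G.directed S u j ∧
        LatentSource G.directed S v k ∧ (u = v ∨ G.bidirected.Adj u v)
      symm := ⟨fun _ _ ⟨hne, u, v, hu, hv, h⟩ =>
        ⟨hne.symm, v, u, hv, hu, h.imp Eq.symm fun h => G.bidirected.adj_symm h⟩⟩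
      loopless := ⟨fun _ h => h.1 rfl⟩ }
  acyclic := G.acyclic.latentProjection S

/-! ## Structural causal models -/

/-- An acyclic structural causal model with endogenous variables `X_j` (`j : V`) valued in `M` and
jointly independent noise variables `N_w` (`w : W`) valued in `Ω w`. The assignment of `j` reads
`X_j := f_j ((X_i)_{i parent of j}, (N_w)_{w ∈ noise j})`. A model without confounding has `W = V`
and `noise j = {j}`; assignments that share a noise variable are confounded. -/
structure SCM (V W : Type*) (M : Type u) (Ω : W → Type u) [MeasurableSpace M]
    [∀ w, MeasurableSpace (Ω w)] where
  /-- the directed graph: `dag.Adj i j` says that `i` is a parent of `j` -/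
  dag : Digraph V
  acyclic : dag.IsAcyclic
  /-- the noise variables that enter the assignment of `j` -/
  noise : V → Set W
  assign : ∀ j, ({i // dag.Adj i j} → M) → ((w : noise j) → Ω w) → M
  measurable_assign : ∀ j, Measurable (Function.uncurry (assign j))
  noiseLaw : ∀ w, ProbabilityMeasure (Ω w)

theorem Digraph.IsAcyclic.wellFounded {V : Type*} [Finite V] {G : Digraph V} (hG : G.IsAcyclic) :
    WellFounded G.Adj := by
  have : Std.Irrefl (Relation.TransGen G.Adj) := ⟨hG⟩
  have : IsTrans V (Relation.TransGen G.Adj) := ⟨fun _ _ _ => Relation.TransGen.trans⟩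
  exact Subrelation.wf (fun h => Relation.TransGen.single h)
    (Finite.wellFounded_of_trans_of_irrefl (Relation.TransGen G.Adj))

namespace SCM

noncomputable section

variable {V W : Type*} {M : Type u} {Ω : W → Type u} [MeasurableSpace M]
  [∀ w, MeasurableSpace (Ω w)]

/-- The ADMG of a model: bidirected edges join the variables that share a noise variable. -/
def admg (C : SCM V W M Ω) : ADMG V where
  directed := C.dag
  bidirected :=
    { Adj := fun j k => j ≠ k ∧ (C.noise j ∩ C.noise k).Nonempty
      symm := ⟨fun _ _ ⟨hne, h⟩ => ⟨hne.symm, by rwa [Set.inter_comm]⟩⟩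
      loopless := ⟨fun _ h => h.1 rfl⟩ }
  acyclic := C.acyclic

/-- The unique solution of the structural assignments for given noise values. -/
def solve [Finite V] (C : SCM V W M Ω) (e : (w : W) → Ω w) : V → M :=
  C.acyclic.wellFounded.fix fun j X =>
    C.assign j (fun i => X i.1 i.2) (fun w => e w)

theorem solve_eq [Finite V] (C : SCM V W M Ω) (e : (w : W) → Ω w) (j : V) :
    C.solve e j = C.assign j (fun i => C.solve e i) (fun w => e w) :=
  C.acyclic.wellFounded.fix_eq _ j

theorem measurable_solve [Finite V] (C : SCM V W M Ω) : Measurable C.solve := by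
  refine measurable_pi_lambda _ fun j => ?_
  induction j using C.acyclic.wellFounded.induction with
  | _ j ih =>
    have h : (fun e => C.solve e j) = fun e =>
        Function.uncurry (C.assign j) (fun i => C.solve e i, fun w => e w) :=
      funext fun e => C.solve_eq e j
    rw [h]
    refine (C.measurable_assign j).comp (Measurable.prodMk ?_ ?_)
    · exact measurable_pi_lambda _ fun i => ih i.1 i.2
    · exact measurable_pi_lambda _ fun w => measurable_pi_apply _

/-- The joint law of the jointly independent noise variables. -/
def noiseJoint [Fintype W] (C : SCM V W M Ω) : ProbabilityMeasure ((w : W) → Ω w) :=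
  ⟨Measure.pi fun w => (C.noiseLaw w : Measure (Ω w)), inferInstance⟩

/-- The distribution `P_X` entailed by the model. -/
def law [Finite V] [Fintype W] (C : SCM V W M Ω) : ProbabilityMeasure (V → M) :=
  C.noiseJoint.map C.measurable_solve.aemeasurable

/-- The marginal distribution `P_{X_j}`. -/
def marginalLaw [Finite V] [Fintype W] (C : SCM V W M Ω) (j : V) : ProbabilityMeasure M :=
  C.law.map (measurable_pi_apply j).aemeasurable

/-! ### Interventions -/

/-- Value spaces of the noise variables after one new `M`-valued variable has been added. -/
abbrev ExtNoise (M : Type u) (Ω : W → Type u) : Option W → Type u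
  | none => M
  | some w => Ω w

instance instExtNoise : ∀ o : Option W, MeasurableSpace (ExtNoise M Ω o)
  | none => inferInstanceAs (MeasurableSpace M)
  | some w => inferInstanceAs (MeasurableSpace (Ω w))

/-- The intervened model `do(X_k := Ñ_k)`: the assignment of `k` is replaced by `X_k := Ñ_k`, where
`Ñ_k` is a new variable with law `ν`, independent of all noise variables. The other assignments
are kept. -/
def intervene [DecidableEq V] (C : SCM V W M Ω) (k : V) (ν : ProbabilityMeasure M) :
    SCM V (Option W) M (ExtNoise M Ω) where
  dag := { Adj := fun i j => j ≠ k ∧ C.dag.Adj i j }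
  acyclic := fun v h => C.acyclic v (Relation.TransGen.mono (r := fun i j => j ≠ k ∧ C.dag.Adj i j)
    (fun _ _ h' => h'.2) _ _ h)
  noise j := {o | if j = k then o = none else ∃ w ∈ C.noise j, o = some w}
  assign j x n :=
    if h : j = k then n ⟨none, by simp [h]⟩
    else C.assign j (fun i => x ⟨i.1, h, i.2⟩) (fun w => n ⟨some w.1, by simp [h]⟩)
  measurable_assign j := by
    by_cases h : j = k
    · simp only [h, dite_true, Function.uncurry_def]
      exact (measurable_pi_apply (X := fun o : {o : Option W // _} => ExtNoise M Ω o.1) _).comp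
        measurable_snd
    · simp only [h, dite_false, Function.uncurry_def]
      refine (C.measurable_assign j).comp (Measurable.prodMk ?_ ?_)
      · exact measurable_pi_lambda _ fun i => (measurable_pi_apply _).comp measurable_fst
      · exact measurable_pi_lambda _ fun w =>
          (measurable_pi_apply (X := fun o : {o : Option W // _} => ExtNoise M Ω o.1) _).comp
            measurable_snd
  noiseLaw
    | none => ν
    | some w => C.noiseLaw w

/-! ### Marginalization -/

/-- The noise variables that enter the assignment of `j` once the variables outside `S` have been
substituted away. -/
def margNoise (C : SCM V W M Ω) (S : Set V) (j : V) : Set W :=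
  {w | ∃ u, LatentSource C.dag S u j ∧ w ∈ C.noise u}

/-- The observed parents of `j` after substitution. -/
abbrev MargParent (C : SCM V W M Ω) (S : Set V) (j : V) : Type _ :=
  {i : S // LatentPath C.dag S i j}

theorem latentSource_of_adj (C : SCM V W M Ω) {S : Set V} {u i j : V}
    (h : LatentSource C.dag S u i) (hi : i ∉ S) (hij : C.dag.Adj i j) :
    LatentSource C.dag S u j := by
  rcases h with rfl | ⟨hu, hp⟩
  · exact Or.inr ⟨hi, .edge hij⟩
  · exact Or.inr ⟨hu, .snoc hp hi hij⟩

open Classical in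
/-- The assignment of `j` in which every parent outside `S` is recursively replaced by its own
assignment. -/
def margAssign [Finite V] (C : SCM V W M Ω) (S : Set V) :
    ∀ j : V, (C.MargParent S j → M) → ((w : C.margNoise S j) → Ω w) → M :=
  C.acyclic.wellFounded.fix fun j F x n =>
    C.assign j
      (fun i =>
        if hi : i.1 ∈ S then x ⟨⟨i.1, hi⟩, .edge i.2⟩
        else F i.1 i.2 (fun p => x ⟨p.1, .snoc p.2 hi i.2⟩)
          (fun w => n ⟨w.1, w.2.imp fun _ h => ⟨C.latentSource_of_adj h.1 hi i.2, h.2⟩⟩))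
      (fun w => n ⟨w.1, j, Or.inl rfl, w.2⟩)

open Classical in
theorem margAssign_eq [Finite V] (C : SCM V W M Ω) (S : Set V) (j : V)
    (x : C.MargParent S j → M) (n : (w : C.margNoise S j) → Ω w) :
    C.margAssign S j x n = C.assign j
      (fun i =>
        if hi : i.1 ∈ S then x ⟨⟨i.1, hi⟩, .edge i.2⟩
        else C.margAssign S i.1 (fun p => x ⟨p.1, .snoc p.2 hi i.2⟩)
          (fun w => n ⟨w.1, w.2.imp fun _ h => ⟨C.latentSource_of_adj h.1 hi i.2, h.2⟩⟩))
      (fun w => n ⟨w.1, j, Or.inl rfl, w.2⟩) := by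
  unfold margAssign
  rw [C.acyclic.wellFounded.fix_eq]

theorem measurable_margAssign [Finite V] (C : SCM V W M Ω) (S : Set V) (j : V) :
    Measurable (Function.uncurry (C.margAssign S j)) := by
  classical
  induction j using C.acyclic.wellFounded.induction with
  | _ j ih =>
    have h : Function.uncurry (C.margAssign S j) = fun p =>
        Function.uncurry (C.assign j)
          (fun i =>
            if hi : i.1 ∈ S then p.1 ⟨⟨i.1, hi⟩, .edge i.2⟩
            else Function.uncurry (C.margAssign S i.1)
              (fun q => p.1 ⟨q.1, .snoc q.2 hi i.2⟩, fun w => p.2 ⟨w.1,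
                w.2.imp fun _ h => ⟨C.latentSource_of_adj h.1 hi i.2, h.2⟩⟩),
            fun w => p.2 ⟨w.1, j, Or.inl rfl, w.2⟩) := by
      funext p
      simp only [Function.uncurry_def]
      convert C.margAssign_eq S j p.1 p.2
    rw [h]
    refine (C.measurable_assign j).comp (Measurable.prodMk ?_ ?_)
    · refine measurable_pi_lambda _ fun i => ?_
      by_cases hi : i.1 ∈ S
      · simp only [hi, dite_true]
        exact (measurable_pi_apply _).comp measurable_fst
      · simp only [hi, dite_false]
        refine (ih i.1 i.2).comp (Measurable.prodMk ?_ ?_)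
        · exact measurable_pi_lambda _ fun q => (measurable_pi_apply _).comp measurable_fst
        · exact measurable_pi_lambda _ fun w =>
            (measurable_pi_apply (X := fun w : C.margNoise S j => Ω w.1) _).comp measurable_snd
    · exact measurable_pi_lambda _ fun w =>
        (measurable_pi_apply (X := fun w : C.margNoise S j => Ω w.1) _).comp measurable_snd

/-- The marginalized model on the observed variables `S`: the latent variables are substituted
away, and the noise variables with their laws are kept. -/
def marginalize [Finite V] (C : SCM V W M Ω) (S : Set V) : SCM S W M Ω where
  dag := C.dag.latentProjection S
  acyclic := C.acyclic.latentProjection S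
  noise j := C.margNoise S j
  assign j := C.margAssign S j
  measurable_assign j := C.measurable_margAssign S j
  noiseLaw := C.noiseLaw

/-! ### Interventional faithfulness -/

/-- `(Ñ, C)` is `ε`-interventionally faithful to the directed graph `G`, where `Ñ k` is the law of
the variable assigned to `X_k` by the intervention on `k ∈ I`, and `D` is the distance between
probability measures. -/
def IsInterventionallyFaithful [Finite V] [DecidableEq V] [Fintype W] (C : SCM V W M Ω)
    (D : ProbabilityMeasure M → ProbabilityMeasure M → NNReal) (ε : ℝ) (G : Digraph V)
    (I : Set V) (Ntilde : I → ProbabilityMeasure M) : Prop :=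
  ∀ (i : I) (j : V), i.1 ≠ j →
    (ε < D (C.marginalLaw j) ((C.intervene i.1 (Ntilde i)).marginalLaw j) ↔
      Relation.TransGen G.Adj i.1 j)

end

end SCM

/-!
Marginalizing a structural causal model and passing to the latent projection preserve both sides of
the equivalence that defines interventional faithfulness, so faithfulness is inherited from the
full model.

* On the side of distributions, marginalization commutes with solving the model. If `y : V → M`
  satisfies the structural equations of all latent variables, then the substituted assignment of `j`
  returns the same value on `y` as the original one (`SCM.margAssign_eq_assign`, by recursion along
  the acyclic graph). Applied to the solution of the observational model this shows that the
  marginalized model has the same solution on the observed variables (`SCM.solve_marginalize`).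
  Applied to the solution of the model intervened on an observed variable `k`, whose latent equations
  are those of the original model because `k` is not latent, it shows the same after intervention
  (`SCM.solve_intervene_marginalize`). The noise is the same in both models, so the marginal laws
  agree (`SCM.marginalLaw_congr`).
* On the side of graphs, a directed path between observed nodes can be cut at its observed nodes into
  segments with latent intermediate nodes, each of which is an edge of the latent projection
  (`Digraph.transGen_latentProjection_iff`).
-/

/-- Reachability between observed nodes is the same in a graph and in its latent projection. -/
theorem Digraph.transGen_latentProjection_iff {V : Type*} (G : Digraph V) (S : Set V) (i j : S) :
    Relation.TransGen (G.latentProjection S).Adj i j ↔ Relation.TransGen G.Adj i j := by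
  constructor
  · intro h
    induction h with
    | single h => exact LatentPath.transGen h
    | tail _ h ih => exact ih.trans (LatentPath.transGen h)
  · intro h
    -- `s` is the last observed node before `v` on the path.
    have key : ∀ v, Relation.TransGen G.Adj i v →
        ∃ s : S, Relation.ReflTransGen (G.latentProjection S).Adj i s ∧ LatentPath G S s v := by
      intro v hv
      induction hv with
      | single h => exact ⟨i, .refl, .edge h⟩
      | @tail b c _ hbc ih =>
        obtain ⟨s, his, hsb⟩ := ih
        by_cases hb : b ∈ S
        · exact ⟨⟨b, hb⟩, his.tail hsb, .edge hbc⟩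
        · exact ⟨s, his, .snoc hsb hb hbc⟩
    obtain ⟨s, his, hsj⟩ := key j h
    exact Relation.TransGen.tail' his hsj

namespace SCM

variable {V W : Type*} {M : Type u} {Ω : W → Type u} [MeasurableSpace M]
  [∀ w, MeasurableSpace (Ω w)]

/-- On values `y` that satisfy the structural equations of all latent variables, substituting the
latent variables does not change the assignment of `j`. -/
theorem margAssign_eq_assign [Finite V] (C : SCM V W M Ω) (S : Set V) (y : V → M)
    (e : (w : W) → Ω w)
    (hy : ∀ u ∉ S, y u = C.assign u (fun i => y i) (fun w => e w)) (j : V) :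
    C.margAssign S j (fun p => y p.1) (fun w => e w) =
      C.assign j (fun i => y i) (fun w => e w) := by
  induction j using C.acyclic.wellFounded.induction with
  | _ j ih =>
    rw [margAssign_eq]
    congr 1
    funext i
    split_ifs with hi
    · rfl
    · exact (ih i.1 i.2).trans (hy i.1 hi).symm

theorem solve_marginalize [Finite V] (C : SCM V W M Ω) (S : Set V) (e : (w : W) → Ω w) (j : S) :
    (C.marginalize S).solve e j = C.solve e j := by
  induction j using (C.marginalize S).acyclic.wellFounded.induction with
  | _ j ih =>
    rw [solve_eq, C.solve_eq e j,
      ← C.margAssign_eq_assign S (C.solve e) e (fun u _ => C.solve_eq e u) j]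
    change C.margAssign S j _ _ = _
    congr 1
    funext p
    exact ih p.1 p.2

theorem solve_intervene_self [Finite V] [DecidableEq V] (C : SCM V W M Ω) (k : V)
    (ν : ProbabilityMeasure M) (e : (o : Option W) → ExtNoise M Ω o) :
    (C.intervene k ν).solve e k = e none := by
  rw [solve_eq]
  simp [intervene]

theorem solve_intervene_of_ne [Finite V] [DecidableEq V] (C : SCM V W M Ω) {k j : V}
    (ν : ProbabilityMeasure M) (e : (o : Option W) → ExtNoise M Ω o) (hj : j ≠ k) :
    (C.intervene k ν).solve e j =
      C.assign j (fun i => (C.intervene k ν).solve e i) (fun w => e (some w)) := by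
  rw [solve_eq]
  simp only [intervene, hj, dite_false]

theorem solve_intervene_marginalize [Finite V] [DecidableEq V] (C : SCM V W M Ω) (S : Set V)
    (k : S) (ν : ProbabilityMeasure M) (e : (o : Option W) → ExtNoise M Ω o) (j : S) :
    ((C.marginalize S).intervene k ν).solve e j = (C.intervene k.1 ν).solve e j := by
  induction j using (C.marginalize S).acyclic.wellFounded.induction with
  | _ j ih =>
    by_cases hj : j = k
    · subst hj
      rw [solve_intervene_self, solve_intervene_self]
    · rw [solve_intervene_of_ne _ _ _ hj,
        solve_intervene_of_ne _ _ _ (fun h => hj (Subtype.ext h)),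
        ← C.margAssign_eq_assign S ((C.intervene k.1 ν).solve e) (fun w => e (some w))
          (fun u hu => C.solve_intervene_of_ne ν e (fun h => hu (h ▸ k.2))) j]
      change C.margAssign S j _ _ = _
      congr 1
      funext p
      exact ih p.1 p.2

/-- Models over possibly different variables with the same noise have equal marginal laws at
variables with equal solutions. -/
theorem marginalLaw_congr {V₁ V₂ : Type*} [Finite V₁] [Finite V₂] [Fintype W]
    {C₁ : SCM V₁ W M Ω} {C₂ : SCM V₂ W M Ω} {j₁ : V₁} {j₂ : V₂}
    (hnoise : C₁.noiseLaw = C₂.noiseLaw) (hsolve : ∀ e, C₁.solve e j₁ = C₂.solve e j₂) :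
    C₁.marginalLaw j₁ = C₂.marginalLaw j₂ := by
  apply Subtype.ext
  change (((Measure.pi fun w => (C₁.noiseLaw w : Measure (Ω w))).map C₁.solve).map fun x => x j₁) =
    (((Measure.pi fun w => (C₂.noiseLaw w : Measure (Ω w))).map C₂.solve).map fun x => x j₂)
  rw [Measure.map_map (measurable_pi_apply j₁) C₁.measurable_solve,
    Measure.map_map (measurable_pi_apply j₂) C₂.measurable_solve, hnoise]
  congr 1
  exact funext hsolve

theorem marginalLaw_marginalize [Finite V] [Fintype W] (C : SCM V W M Ω) (S : Set V) (j : S) :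
    (C.marginalize S).marginalLaw j = C.marginalLaw j :=
  marginalLaw_congr rfl fun e => C.solve_marginalize S e j

theorem marginalLaw_intervene_marginalize [Finite V] [DecidableEq V] [Fintype W]
    (C : SCM V W M Ω) (S : Set V) (k : S) (ν : ProbabilityMeasure M) (j : S) :
    ((C.marginalize S).intervene k ν).marginalLaw j = (C.intervene k.1 ν).marginalLaw j :=
  marginalLaw_congr (funext fun o => by cases o <;> rfl)
    fun e => C.solve_intervene_marginalize S k ν e j

end SCM

theorem mainTheorem8 {V W : Type*} [Finite V] [DecidableEq V] [Fintype W]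
    {M : Type u} [MetricSpace M] [MeasurableSpace M] [BorelSpace M]
    {Ω : W → Type u} [∀ w, MeasurableSpace (Ω w)]
    (D : ProbabilityMeasure M → ProbabilityMeasure M → NNReal) (ε : ℝ)
    (C : SCM V W M Ω) (I : Set V) (Ntilde : I → ProbabilityMeasure M)
    (hfaith : C.IsInterventionallyFaithful D ε C.admg.directed I Ntilde)
    (V' : Set V) :
    (C.marginalize V').IsInterventionallyFaithful D ε
      (C.admg.latentProjection V').directed
      {k : V' | (k : V) ∈ I} (fun k => Ntilde ⟨k.1, k.2⟩) := by
  intro i j hij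
  rw [SCM.marginalLaw_marginalize, SCM.marginalLaw_intervene_marginalize]
  exact (hfaith ⟨i.1, i.2⟩ j fun h => hij (Subtype.ext h)).trans
    (C.dag.transGen_latentProjection_iff V' i.1 j).symm
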